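/- Let $d\in\mathbb N$, $p\in[1,\infty)$, and let $P_0$ be a Borel probability measure on $\mathbb R^d$ with $\int \|x\|^p\,dP_0(x)<\infty$, where $\|\cdot\|$ is the Euclidean norm. For Borel probability measures $\mu,\nu$ on $\mathbb R^d$ let $$W_p(\mu,\nu)=\Bigl(\inf_{\gamma\in\Gamma(\mu,\nu)}\int\|x-y\|^p\,d\gamma(x,y)\Bigr)^{1/p},$$ where $\Gamma(\mu,\nu)$ is the set of probability measures on $\mathbb R^d\times\mathbb R^d$ with marginals $\mu$ and $\nu$. For a sample $X_1,\dots,X_n$ in $\mathbb R^d$ let $\hat P_n=n^{-1}\sum_{i=1}^n\delta_{X_i}$ and $T_n=W_p^p(\hat P_n,P_0)$. For a probability measure $P$ write $P^n$ for its $n$-fold product, the law of an i.i.d. sample of size $n$ from $P$. Put $F_n(t)=P_0^n[T_n\le t]$ and, for $\alpha>0$, $c(\alpha,n,P_0)=\inf\{t>0: F_n(t)\ge 1-\alpha\}$. Let $\phi^n_{P_0}=1$ if $T_n\ge c(\alpha,n,P_0)$ (equivalently, if the $p$-value satisfies $1-F_n(T_n)\le\alpha$) and $\phi^n_{P_0}=0$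 otherwise. Then for every $\alpha>0$ and every Borel probability measure $P\ne P_0$ on $\mathbb R^d$, whether or not $P$ has a finite $p$-th moment, $$\lim_{n\to\infty}P^n[\phi^n_{P_0}=1]=1,\qquad \lim_{n\to\infty}P^n[1-F_n(T_n)\le\alpha]=1,\qquad \lim_{n\to\infty}P^n[T_n>c(\alpha,n,P_0)]=1 .$$ -/

import Mathlib

open MeasureTheory Filter Topology
open scoped ENNReal

noncomputable section

/-- `ℝ^d` with the Euclidean norm. -/
abbrev Rd (d : ℕ) : Type := EuclideanSpace ℝ (Fin d)

/-- `γ` is a coupling of `μ` and `ν`: its marginals are `μ` and `ν`.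
For probability measures `μ`, `ν` such a `γ` is automatically a probability measure. -/
def IsCoupling {d : ℕ} (μ ν : Measure (Rd d)) (γ : Measure (Rd d × Rd d)) : Prop :=
  (∀ B : Set (Rd d), MeasurableSet B → γ (B ×ˢ Set.univ) = μ B) ∧
  (∀ B : Set (Rd d), MeasurableSet B → γ (Set.univ ×ˢ B) = ν B)

/-- The `p`-Wasserstein distance, as an extended nonnegative number
(finite when both measures are probability measures with finite `p`-th moment). -/
def wassersteinDist {d : ℕ} (p : ℝ) (μ ν : Measure (Rd d)) : ℝ≥0∞ :=
  (⨅ γ : {γ : Measure (Rd d × Rd d) // IsCoupling μ ν γ},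
    ∫⁻ z, ENNReal.ofReal (‖z.1 - z.2‖ ^ p) ∂γ.1) ^ (1 / p)

/-- The empirical distribution `n⁻¹ ∑ δ_{x_i}` of a sample of size `n`. -/
def empiricalMeasure {d n : ℕ} (x : Fin n → Rd d) : Measure (Rd d) :=
  (n : ℝ≥0∞)⁻¹ • ∑ i, Measure.dirac (x i)

/-- The law `P^n` of an i.i.d. sample of size `n` from `P`. -/
def sampleLaw {d : ℕ} (P : Measure (Rd d)) (n : ℕ) : Measure (Fin n → Rd d) :=
  Measure.pi fun _ => P

/-- The test statistic `T_n = W_p^p(P_n, P₀)`. -/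
def testStat {d n : ℕ} (p : ℝ) (P₀ : Measure (Rd d)) (x : Fin n → Rd d) : ℝ :=
  (wassersteinDist p (empiricalMeasure x) P₀).toReal ^ p

/-- The null distribution function `F_n(t) = P₀^n[T_n ≤ t]`. -/
def nullCDF {d : ℕ} (p : ℝ) (P₀ : Measure (Rd d)) (n : ℕ) (t : ℝ) : ℝ :=
  (sampleLaw P₀ n).real {x | testStat p P₀ x ≤ t}

/-- The critical value `c(α, n, P₀) = inf {t > 0 : F_n(t) ≥ 1 - α}`. -/
def criticalValue {d : ℕ} (p : ℝ) (P₀ : Measure (Rd d)) (α : ℝ) (n : ℕ) : ℝ :=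
  sInf {t : ℝ | 0 < t ∧ 1 - α ≤ nullCDF p P₀ n t}

/-- The `p`-value `1 - F_n(T_n)`. -/
def pValue {d n : ℕ} (p : ℝ) (P₀ : Measure (Rd d)) (x : Fin n → Rd d) : ℝ :=
  1 - nullCDF p P₀ n (testStat p P₀ x)

/-- The test: `1` (reject) if `T_n ≥ c(α, n, P₀)` and `0` otherwise. -/
def wassersteinTest {d n : ℕ} (p : ℝ) (P₀ : Measure (Rd d)) (α : ℝ) (x : Fin n → Rd d) : ℕ :=
  if criticalValue p P₀ α n ≤ testStat p P₀ x then 1 else 0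

end

/-! Two facts give consistency. Under `P₀` the statistic tends to zero in probability, so the
critical value eventually lies below any fixed positive level. Under `P ≠ P₀` the statistic stays
above some `ε > 0` with probability tending to one. Comparing at level `ε / 2` gives all three
limits.

For the first fact (`tendsto_sampleLaw_transportCost`), cut space into small cells. Inside each of
finitely many cells couple as much mass as both measures share, and join what remains by a product
measure (`transportCost_le_of_cells`). The cost is then controlled by the cell diameter, the
differences of cell masses and the `p`-th moment tails. Chebyshev's inequality handles the masses
and Markov's the empirical tail.

For the second fact, a bounded Lipschitz `f` separates `P` from `P₀` (a sine or cosine, by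
injectivity of the characteristic function). Empirical means of `f` converge under `P`, and a gap
between means forces transport cost (`ofReal_rpow_le_transportCost`). Only boundedness of `f` is
used, so `P` needs no moment. -/

/-! ### Transport cost and completion of sub-couplings -/

/-- The infimum of the transport costs, that is `W_p^p`. -/
noncomputable def transportCost {d : ℕ} (p : ℝ) (μ ν : Measure (Rd d)) : ℝ≥0∞ :=
  ⨅ γ : {γ : Measure (Rd d × Rd d) // IsCoupling μ ν γ},
    ∫⁻ z, ENNReal.ofReal (‖z.1 - z.2‖ ^ p) ∂γ.1

theorem testStat_eq_toReal_transportCost {d n : ℕ} {p : ℝ} (hp : 1 ≤ p) (P₀ : Measure (Rd d))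
    (x : Fin n → Rd d) :
    testStat p P₀ x = (transportCost p (empiricalMeasure x) P₀).toReal := by
  have hp0 : p ≠ 0 := by positivity
  rw [testStat, wassersteinDist, ENNReal.toReal_rpow, ← ENNReal.rpow_mul, one_div,
    inv_mul_cancel₀ hp0, ENNReal.rpow_one, transportCost]

theorem ofReal_norm_sub_rpow_le {d : ℕ} {p : ℝ} (hp : 1 ≤ p) (x y : Rd d) :
    ENNReal.ofReal (‖x - y‖ ^ p) ≤
      ENNReal.ofReal (2 ^ p) * (ENNReal.ofReal (‖x‖ ^ p) + ENNReal.ofReal (‖y‖ ^ p)) := by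
  have hp0 : 0 ≤ p := by linarith
  rw [← ENNReal.ofReal_add (by positivity) (by positivity), ← ENNReal.ofReal_mul (by positivity)]
  apply ENNReal.ofReal_le_ofReal
  calc ‖x - y‖ ^ p ≤ (2 * max ‖x‖ ‖y‖) ^ p := by
        apply Real.rpow_le_rpow (norm_nonneg _) _ hp0
        have := norm_sub_le x y
        have := le_max_left ‖x‖ ‖y‖
        have := le_max_right ‖x‖ ‖y‖
        linarith
    _ = 2 ^ p * (max ‖x‖ ‖y‖) ^ p := Real.mul_rpow (by positivity) (by positivity)
    _ ≤ 2 ^ p * (‖x‖ ^ p + ‖y‖ ^ p) := by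
        gcongr
        rcases max_cases ‖x‖ ‖y‖ with ⟨h, -⟩ | ⟨h, -⟩ <;> rw [h] <;>
          linarith [Real.rpow_nonneg (norm_nonneg x) p, Real.rpow_nonneg (norm_nonneg y) p]

/-- A sub-coupling can be completed to a coupling by adding a multiple of the product of the
residual marginals. -/
theorem transportCost_le_of_subcoupling {d : ℕ} {p : ℝ} (hp : 1 ≤ p) (μ ν : Measure (Rd d))
    [IsProbabilityMeasure μ] [IsProbabilityMeasure ν] (γ : Measure (Rd d × Rd d))
    (h₁ : γ.fst ≤ μ) (h₂ : γ.snd ≤ ν) :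
    transportCost p μ ν ≤ ∫⁻ z, ENNReal.ofReal (‖z.1 - z.2‖ ^ p) ∂γ +
      ENNReal.ofReal (2 ^ p) * (∫⁻ x, ENNReal.ofReal (‖x‖ ^ p) ∂(μ - γ.fst) +
        ∫⁻ y, ENNReal.ofReal (‖y‖ ^ p) ∂(ν - γ.snd)) := by
  have : IsFiniteMeasure γ.fst := isFiniteMeasure_of_le μ h₁
  have : IsFiniteMeasure γ.snd := isFiniteMeasure_of_le ν h₂
  set ρ := μ - γ.fst with hρ
  set σ := ν - γ.snd with hσ
  have hρ' : ρ + γ.fst = μ := Measure.sub_add_cancel_of_le h₁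
  have hσ' : σ + γ.snd = ν := Measure.sub_add_cancel_of_le h₂
  have : IsFiniteMeasure ρ := isFiniteMeasure_of_le μ Measure.sub_le
  have : IsFiniteMeasure σ := isFiniteMeasure_of_le ν Measure.sub_le
  set r := ρ Set.univ with hr
  have hrσ : σ Set.univ = r := by
    rw [hr, hρ, hσ, Measure.sub_apply .univ h₁, Measure.sub_apply .univ h₂]
    simp [Measure.fst_univ, Measure.snd_univ]
  have hrtop : r ≠ ∞ := measure_ne_top _ _
  -- If `r = 0` the inverse is `∞`, but then both residuals vanish and `∞ * 0 = 0` gives the right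
  -- value.
  have hcancel : ∀ a : ℝ≥0∞, (r = 0 → a = 0) → r⁻¹ * (a * r) = a := by
    intro a ha
    rcases eq_or_ne r 0 with h | h
    · simp [ha h]
    · rw [mul_comm a, ← mul_assoc, ENNReal.inv_mul_cancel h hrtop, one_mul]
  have hcpl : IsCoupling μ ν (γ + r⁻¹ • ρ.prod σ) := by
    refine ⟨fun B hB => ?_, fun B hB => ?_⟩
    · have h0 : r = 0 → ρ B = 0 := fun h => measure_mono_null (Set.subset_univ B) h
      rw [Measure.add_apply, Measure.smul_apply, Measure.prod_prod, hrσ, smul_eq_mul,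
        hcancel _ h0, Set.prod_univ, ← Measure.fst_apply hB, add_comm, ← Measure.add_apply, hρ']
    · have h0 : r = 0 → σ B = 0 := fun h =>
        measure_mono_null (Set.subset_univ B) (hrσ.trans h)
      rw [Measure.add_apply, Measure.smul_apply, Measure.prod_prod, ← hr, smul_eq_mul,
        mul_comm r, hcancel _ h0, Set.univ_prod, ← Measure.snd_apply hB, add_comm,
        ← Measure.add_apply, hσ']
  refine (iInf_le _ ⟨_, hcpl⟩).trans ?_
  rw [lintegral_add_measure, lintegral_smul_measure]
  gcongr
  have hm : Measurable fun x : Rd d => ENNReal.ofReal (‖x‖ ^ p) := by fun_prop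
  calc r⁻¹ • ∫⁻ z, ENNReal.ofReal (‖z.1 - z.2‖ ^ p) ∂(ρ.prod σ)
      ≤ r⁻¹ * ∫⁻ z, ENNReal.ofReal (2 ^ p) *
          (ENNReal.ofReal (‖z.1‖ ^ p) + ENNReal.ofReal (‖z.2‖ ^ p)) ∂(ρ.prod σ) := by
        rw [smul_eq_mul]
        gcongr with z
        exact ofReal_norm_sub_rpow_le hp _ _
    _ = ENNReal.ofReal (2 ^ p) * (r⁻¹ * ((∫⁻ x, ENNReal.ofReal (‖x‖ ^ p) ∂ρ) * r) +
          r⁻¹ * ((∫⁻ y, ENNReal.ofReal (‖y‖ ^ p) ∂σ) * r)) := by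
        rw [lintegral_const_mul _ (by fun_prop), lintegral_add_left (by fun_prop),
          lintegral_prod _ (by fun_prop), lintegral_prod _ (by fun_prop)]
        simp only [lintegral_const, hrσ]
        rw [lintegral_mul_const _ hm, ← hr]
        ring
    _ = _ := by
        rw [hcancel, hcancel]
        · intro h
          rw [Measure.measure_univ_eq_zero.1 (hrσ.trans h), lintegral_zero_measure]
        · intro h
          rw [Measure.measure_univ_eq_zero.1 h, lintegral_zero_measure]

/-! ### Upper bound from masses of cells -/

theorem max_inv_mul_mul_le_left (a b c : ℝ≥0∞) : (max a b)⁻¹ * (c * b) ≤ c := by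
  calc (max a b)⁻¹ * (c * b) = c * (b * (max a b)⁻¹) := by ring
    _ ≤ c * 1 := by
        gcongr
        rw [← div_eq_mul_inv]
        exact ENNReal.div_le_of_le_mul (by simp)
    _ = c := mul_one c

/-- For finite `a`, `b` the weight turns the product `a * b` into `min a b`, the mass a cell can
keep; what is left over is the truncated excess. -/
theorem tsub_max_inv_mul_mul_le (a b : ℝ≥0∞) (ha : a ≠ ∞) (hb : b ≠ ∞) :
    a - (max a b)⁻¹ * (a * b) ≤ a - b := by
  rcases le_total a b with h | h
  · rw [max_eq_right h]
    rcases eq_or_ne b 0 with rfl | hb0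
    · simp_all
    · rw [mul_comm a, ← mul_assoc, ENNReal.inv_mul_cancel hb0 hb, one_mul]
      simp
  · rw [max_eq_left h]
    rcases eq_or_ne a 0 with rfl | ha0
    · simp_all
    · rw [← mul_assoc, ENNReal.inv_mul_cancel ha0 ha, one_mul]

/-- The piece of the product coupling that moves mass only within the cells `A j`. -/
noncomputable def cellCoupling {d : ℕ} (μ ν : Measure (Rd d)) (A : ℕ → Set (Rd d)) (N : ℕ) :
    Measure (Rd d × Rd d) :=
  ∑ j ∈ Finset.range N, (max (μ (A j)) (ν (A j)))⁻¹ • (μ.restrict (A j)).prod (ν.restrict (A j))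

section cells

variable {d : ℕ} (μ ν : Measure (Rd d))
  {A : ℕ → Set (Rd d)} (N : ℕ)

theorem cellCoupling_fst_apply [IsProbabilityMeasure ν]
    {B : Set (Rd d)} (hB : MeasurableSet B) :
    (cellCoupling μ ν A N).fst B =
      ∑ j ∈ Finset.range N, (max (μ (A j)) (ν (A j)))⁻¹ * (μ (B ∩ A j) * ν (A j)) := by
  rw [Measure.fst_apply hB, ← Set.prod_univ, cellCoupling, Measure.finsetSum_apply]
  refine Finset.sum_congr rfl fun j _ => ?_
  rw [Measure.smul_apply, Measure.prod_prod, Measure.restrict_apply hB, Measure.restrict_apply_univ,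
    smul_eq_mul]

theorem cellCoupling_snd_apply [IsProbabilityMeasure ν]
    {B : Set (Rd d)} (hB : MeasurableSet B) :
    (cellCoupling μ ν A N).snd B =
      ∑ j ∈ Finset.range N, (max (ν (A j)) (μ (A j)))⁻¹ * (ν (B ∩ A j) * μ (A j)) := by
  rw [Measure.snd_apply hB, ← Set.univ_prod, cellCoupling, Measure.finsetSum_apply]
  refine Finset.sum_congr rfl fun j _ => ?_
  rw [Measure.smul_apply, Measure.prod_prod, Measure.restrict_apply hB, Measure.restrict_apply_univ,
    smul_eq_mul, max_comm, mul_comm (μ _)]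

theorem sum_weighted_inter_le (hA : ∀ j, MeasurableSet (A j)) (hd : Pairwise (Function.onFun Disjoint A))
    {B : Set (Rd d)} (hB : MeasurableSet B) :
    ∑ j ∈ Finset.range N, (max (μ (A j)) (ν (A j)))⁻¹ * (μ (B ∩ A j) * ν (A j)) ≤ μ B :=
  calc _ ≤ ∑ j ∈ Finset.range N, μ (B ∩ A j) :=
        Finset.sum_le_sum fun _ _ => max_inv_mul_mul_le_left _ _ _
    _ = μ (⋃ j ∈ Finset.range N, B ∩ A j) :=
        (measure_biUnion_finset
          (fun _ _ _ _ hij => (hd hij).mono Set.inter_subset_right Set.inter_subset_right)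
          fun j _ => hB.inter (hA j)).symm
    _ ≤ μ B := measure_mono (Set.iUnion₂_subset fun _ _ => Set.inter_subset_left)

theorem cellCoupling_fst_le [IsProbabilityMeasure ν]
    (hA : ∀ j, MeasurableSet (A j)) (hd : Pairwise (Function.onFun Disjoint A)) :
    (cellCoupling μ ν A N).fst ≤ μ :=
  Measure.le_iff.2 fun _ hB =>
    (cellCoupling_fst_apply μ ν N hB).trans_le (sum_weighted_inter_le μ ν N hA hd hB)

theorem cellCoupling_snd_le [IsProbabilityMeasure μ] [IsProbabilityMeasure ν]
    (hA : ∀ j, MeasurableSet (A j)) (hd : Pairwise (Function.onFun Disjoint A)) :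
    (cellCoupling μ ν A N).snd ≤ ν :=
  Measure.le_iff.2 fun _ hB =>
    (cellCoupling_snd_apply μ ν N hB).trans_le (sum_weighted_inter_le ν μ N hA hd hB)

theorem lintegral_cellCoupling_le [IsProbabilityMeasure μ] [IsProbabilityMeasure ν]
    {p : ℝ} (hp : 1 ≤ p) {δ : ℝ}
    (hA : ∀ j, MeasurableSet (A j)) (hd : Pairwise (Function.onFun Disjoint A))
    (hδ : ∀ j, ∀ x ∈ A j, ∀ y ∈ A j, ‖x - y‖ ≤ δ) :
    ∫⁻ z, ENNReal.ofReal (‖z.1 - z.2‖ ^ p) ∂(cellCoupling μ ν A N) ≤ ENNReal.ofReal (δ ^ p) := by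
  have hae : ∀ᵐ z ∂(cellCoupling μ ν A N),
      ENNReal.ofReal (‖z.1 - z.2‖ ^ p) ≤ ENNReal.ofReal (δ ^ p) := by
    rw [ae_iff, cellCoupling, Measure.finsetSum_apply]
    refine Finset.sum_eq_zero fun j _ => ?_
    rw [Measure.smul_apply, Measure.prod_restrict, smul_eq_mul]
    -- The weight is `∞` on a cell null for both measures, so the other factor has to vanish
    -- exactly.
    convert mul_zero _
    rw [← ae_iff]
    refine (ae_restrict_iff' ((hA j).prod (hA j))).2 (Eventually.of_forall fun z hz => ?_)
    exact ENNReal.ofReal_le_ofReal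
      (Real.rpow_le_rpow (norm_nonneg _) (hδ j _ hz.1 _ hz.2) (by linarith))
  calc _ ≤ ∫⁻ _, ENNReal.ofReal (δ ^ p) ∂(cellCoupling μ ν A N) := lintegral_mono_ae hae
    _ = ENNReal.ofReal (δ ^ p) * (cellCoupling μ ν A N).fst Set.univ := by
        rw [lintegral_const, Measure.fst_univ]
    _ ≤ ENNReal.ofReal (δ ^ p) * μ Set.univ := by
        gcongr
        exact cellCoupling_fst_le μ ν N hA hd
    _ = _ := by simp

/-- On the first `N` cells the norm is at most `R` and the residual mass is at most the excess of
`μ` over `ν`; elsewhere the residual is simply dominated by `μ`. -/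
theorem lintegral_residual_le [IsProbabilityMeasure μ] [IsProbabilityMeasure ν]
    {p : ℝ} (hp : 1 ≤ p) {R : ℝ} {κ : Measure (Rd d)}
    [IsFiniteMeasure κ] (hκ : κ ≤ μ)
    (happ : ∀ j ∈ Finset.range N, (max (μ (A j)) (ν (A j)))⁻¹ * (μ (A j) * ν (A j)) ≤ κ (A j))
    (hA : ∀ j, MeasurableSet (A j)) (hR : ∀ j < N, ∀ x ∈ A j, ‖x‖ ≤ R) :
    ∫⁻ x, ENNReal.ofReal (‖x‖ ^ p) ∂(μ - κ) ≤
      ENNReal.ofReal (R ^ p) * ∑ j ∈ Finset.range N, (μ (A j) - ν (A j)) +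
        ∫⁻ x in (⋃ j ∈ Finset.range N, A j)ᶜ, ENNReal.ofReal (‖x‖ ^ p) ∂μ := by
  have hU : MeasurableSet (⋃ j ∈ Finset.range N, A j) :=
    Finset.measurableSet_biUnion _ fun j _ => hA j
  rw [← lintegral_add_compl _ hU]
  refine add_le_add ?_ (lintegral_mono' (Measure.restrict_mono_measure Measure.sub_le _) le_rfl)
  calc _ ≤ ∫⁻ _ in ⋃ j ∈ Finset.range N, A j, ENNReal.ofReal (R ^ p) ∂(μ - κ) := by
        refine setLIntegral_mono measurable_const fun x hx => ?_
        simp only [Set.mem_iUnion, Finset.mem_range, exists_prop] at hx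
        obtain ⟨j, hj, hx⟩ := hx
        exact ENNReal.ofReal_le_ofReal
          (Real.rpow_le_rpow (norm_nonneg _) (hR j hj x hx) (by linarith))
    _ = ENNReal.ofReal (R ^ p) * (μ - κ) (⋃ j ∈ Finset.range N, A j) := setLIntegral_const _ _
    _ ≤ ENNReal.ofReal (R ^ p) * ∑ j ∈ Finset.range N, (μ - κ) (A j) := by
        gcongr
        exact measure_biUnion_finset_le _ _
    _ ≤ _ := by
        gcongr with j hj
        rw [Measure.sub_apply (hA j) hκ]
        exact (tsub_le_tsub_left (happ j hj) _).trans
          (tsub_max_inv_mul_mul_le _ _ (measure_ne_top _ _) (measure_ne_top _ _))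

theorem le_cellCoupling_fst_apply [IsProbabilityMeasure ν]
    (hA : ∀ j, MeasurableSet (A j)) {j : ℕ}
    (hj : j ∈ Finset.range N) :
    (max (μ (A j)) (ν (A j)))⁻¹ * (μ (A j) * ν (A j)) ≤ (cellCoupling μ ν A N).fst (A j) := by
  rw [cellCoupling_fst_apply μ ν N (hA j)]
  refine le_trans ?_ (Finset.single_le_sum (fun _ _ => zero_le) hj)
  rw [Set.inter_self]

theorem le_cellCoupling_snd_apply [IsProbabilityMeasure ν]
    (hA : ∀ j, MeasurableSet (A j)) {j : ℕ}
    (hj : j ∈ Finset.range N) :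
    (max (ν (A j)) (μ (A j)))⁻¹ * (ν (A j) * μ (A j)) ≤ (cellCoupling μ ν A N).snd (A j) := by
  rw [cellCoupling_snd_apply μ ν N (hA j)]
  refine le_trans ?_ (Finset.single_le_sum (fun _ _ => zero_le) hj)
  rw [Set.inter_self]

theorem transportCost_le_of_cells [IsProbabilityMeasure μ] [IsProbabilityMeasure ν]
    {p : ℝ} (hp : 1 ≤ p) {δ R : ℝ}
    (hA : ∀ j, MeasurableSet (A j)) (hd : Pairwise (Function.onFun Disjoint A))
    (hδ : ∀ j, ∀ x ∈ A j, ∀ y ∈ A j, ‖x - y‖ ≤ δ) (hR : ∀ j < N, ∀ x ∈ A j, ‖x‖ ≤ R) :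
    transportCost p μ ν ≤ ENNReal.ofReal (δ ^ p) + ENNReal.ofReal (2 ^ p) *
      ((ENNReal.ofReal (R ^ p) * ∑ j ∈ Finset.range N, (μ (A j) - ν (A j)) +
        ∫⁻ x in (⋃ j ∈ Finset.range N, A j)ᶜ, ENNReal.ofReal (‖x‖ ^ p) ∂μ) +
      (ENNReal.ofReal (R ^ p) * ∑ j ∈ Finset.range N, (ν (A j) - μ (A j)) +
        ∫⁻ x in (⋃ j ∈ Finset.range N, A j)ᶜ, ENNReal.ofReal (‖x‖ ^ p) ∂ν)) := by
  have h₁ := cellCoupling_fst_le μ ν N hA hd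
  have h₂ := cellCoupling_snd_le μ ν N hA hd
  have := isFiniteMeasure_of_le μ h₁
  have := isFiniteMeasure_of_le ν h₂
  refine (transportCost_le_of_subcoupling hp μ ν _ h₁ h₂).trans ?_
  gcongr
  · exact lintegral_cellCoupling_le μ ν N hp hA hd hδ
  · exact lintegral_residual_le μ ν N hp h₁
      (fun j hj => le_cellCoupling_fst_apply μ ν N hA hj) hA hR
  · exact lintegral_residual_le ν μ N hp h₂
      (fun j hj => le_cellCoupling_snd_apply μ ν N hA hj) hA hR

/-- With no cells the bound reduces to the two moments. Finiteness matters because `testStat` passes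
through `toReal`, which sends `∞` to `0`. -/
theorem transportCost_ne_top [IsProbabilityMeasure μ] [IsProbabilityMeasure ν]
    {p : ℝ} (hp : 1 ≤ p)
    (hμ : ∫⁻ x, ENNReal.ofReal (‖x‖ ^ p) ∂μ ≠ ∞) (hν : ∫⁻ x, ENNReal.ofReal (‖x‖ ^ p) ∂ν ≠ ∞) :
    transportCost p μ ν ≠ ∞ := by
  refine ne_top_of_le_ne_top ?_ (transportCost_le_of_cells (A := fun _ => ∅) (δ := 0) (R := 0)
    μ ν 0 hp (by simp) (by simp [Pairwise, Function.onFun]) (by simp) (by simp))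
  simp only [Finset.range_zero, Finset.sum_empty, mul_zero, zero_add, Finset.notMem_empty,
    Set.iUnion_empty, Set.compl_empty, Measure.restrict_univ]
  exact ENNReal.add_ne_top.2 ⟨ENNReal.ofReal_ne_top,
    ENNReal.mul_ne_top ENNReal.ofReal_ne_top (ENNReal.add_ne_top.2 ⟨hμ, hν⟩)⟩

end cells

/-! ### Lower bound from Lipschitz test functions -/

/-- Above the threshold `η`, `s ^ (p - 1)` is at least `η ^ (p - 1)`. This replaces Hölder's
inequality in passing from the linear cost to the `p`-cost. -/
theorem le_add_rpow_mul_rpow {p : ℝ} (hp : 1 ≤ p) {s η : ℝ} (hs : 0 ≤ s) (hη : 0 < η) :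
    s ≤ η + η ^ (1 - p) * s ^ p := by
  rcases le_total s η with h | h
  · have : 0 ≤ η ^ (1 - p) * s ^ p := by positivity
    linarith
  · have hs0 : 0 < s := hη.trans_le h
    have h1 : η ^ (p - 1) * s ≤ s ^ p := by
      calc η ^ (p - 1) * s ≤ s ^ (p - 1) * s := by
            gcongr
        _ = s ^ p := by rw [← Real.rpow_add_one hs0.ne']; ring_nf
    calc s = η ^ (1 - p) * (η ^ (p - 1) * s) := by
          rw [← mul_assoc, ← Real.rpow_add hη]; simp
      _ ≤ η ^ (1 - p) * s ^ p := by gcongr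
      _ ≤ _ := by linarith

/-- Lower bound on the transport cost from a bounded Lipschitz test function. -/
theorem ofReal_rpow_le_transportCost {d : ℕ} {p : ℝ} (hp : 1 ≤ p) (μ ν : Measure (Rd d))
    [IsProbabilityMeasure μ] [IsProbabilityMeasure ν] {f : Rd d → ℝ} (hf : Measurable f)
    (hb : ∀ x, |f x| ≤ 1) {L η : ℝ} (hL : 0 < L) (hη : 0 < η)
    (hLip : ∀ x y, |f x - f y| ≤ L * ‖x - y‖)
    (hgap : 2 * L * η ≤ |∫ x, f x ∂μ - ∫ x, f x ∂ν|) :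
    ENNReal.ofReal (η ^ p) ≤ transportCost p μ ν := by
  refine le_iInf fun ⟨γ, hγ₁, hγ₂⟩ => ?_
  have hfst : γ.map Prod.fst = μ := Measure.ext fun B hB => by
    rw [Measure.map_apply measurable_fst hB, ← Set.prod_univ, hγ₁ B hB]
  have hsnd : γ.map Prod.snd = ν := Measure.ext fun B hB => by
    rw [Measure.map_apply measurable_snd hB, ← Set.univ_prod, hγ₂ B hB]
  have : IsProbabilityMeasure γ := ⟨by rw [← Set.univ_prod_univ, hγ₁ _ .univ, measure_univ]⟩
  by_cases hfin : ∫⁻ z, ENNReal.ofReal (‖z.1 - z.2‖ ^ p) ∂γ = ∞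
  · simp [hfin]
  have hcost : Integrable (fun z : Rd d × Rd d => ‖z.1 - z.2‖ ^ p) γ := by
    have hm : Measurable fun z : Rd d × Rd d => ‖z.1 - z.2‖ ^ p := by fun_prop
    exact (lintegral_ofReal_ne_top_iff_integrable hm.aestronglyMeasurable
      (Eventually.of_forall fun z => by positivity)).1 hfin
  have hbdd : ∀ {g : Rd d × Rd d → Rd d}, Measurable g → Integrable (fun z => f (g z)) γ :=
    fun hg => Integrable.of_bound (hf.comp hg).aestronglyMeasurable 1
      (Eventually.of_forall fun z => hb _)
  rw [← ofReal_integral_eq_lintegral_ofReal hcost (Eventually.of_forall fun z => by positivity)]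
  apply ENNReal.ofReal_le_ofReal
  rw [← hfst, ← hsnd, integral_map measurable_fst.aemeasurable hf.aestronglyMeasurable,
    integral_map measurable_snd.aemeasurable hf.aestronglyMeasurable,
    ← integral_sub (hbdd measurable_fst) (hbdd measurable_snd)] at hgap
  have key : |∫ z, (f z.1 - f z.2) ∂γ| ≤ L * (η + η ^ (1 - p) * ∫ z, ‖z.1 - z.2‖ ^ p ∂γ) := by
    calc |∫ z, (f z.1 - f z.2) ∂γ| ≤ ∫ z, L * (η + η ^ (1 - p) * ‖z.1 - z.2‖ ^ p) ∂γ := by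
          refine norm_integral_le_of_norm_le (f := fun z : Rd d × Rd d => f z.1 - f z.2)
            (((integrable_const η).add (hcost.const_mul _)).const_mul L)
            (Eventually.of_forall fun z => (hLip _ _).trans ?_)
          gcongr
          exact le_add_rpow_mul_rpow hp (norm_nonneg _) hη
      _ = _ := by
          rw [integral_const_mul, integral_add (integrable_const _) (hcost.const_mul _),
            integral_const_mul]
          simp
  set C := ∫ z, ‖z.1 - z.2‖ ^ p ∂γ
  have h1 : η ≤ η ^ (1 - p) * C := by
    have : L * (2 * η) ≤ L * (η + η ^ (1 - p) * C) := by linarith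
    linarith [le_of_mul_le_mul_left this hL]
  calc η ^ p = η ^ (p - 1) * η := by rw [← Real.rpow_add_one hη.ne']; ring_nf
    _ ≤ η ^ (p - 1) * (η ^ (1 - p) * C) := by gcongr
    _ = C := by rw [← mul_assoc, ← Real.rpow_add hη]; simp

/-- Distinct finite measures are separated by a bounded Lipschitz function. -/
theorem exists_lipschitz_integral_ne {d : ℕ} {P Q : Measure (Rd d)} [IsFiniteMeasure P]
    [IsFiniteMeasure Q] (hne : P ≠ Q) :
    ∃ f : Rd d → ℝ, Measurable f ∧ (∀ x, |f x| ≤ 1) ∧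
      (∃ L : ℝ, 0 < L ∧ ∀ x y, |f x - f y| ≤ L * ‖x - y‖) ∧ ∫ x, f x ∂P ≠ ∫ x, f x ∂Q := by
  obtain ⟨t, ht⟩ : ∃ t, charFun P t ≠ charFun Q t := by
    by_contra! h
    exact hne (Measure.ext_of_charFun (funext h))
  have hre : ∀ (μ : Measure (Rd d)) [IsFiniteMeasure μ],
      charFun μ t = ((∫ x, Real.cos (inner ℝ x t) ∂μ : ℝ) : ℂ) +
        ((∫ x, Real.sin (inner ℝ x t) ∂μ : ℝ) : ℂ) * Complex.I := by
    intro μ _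
    have hc : Integrable (fun x : Rd d => (Real.cos (inner ℝ x t) : ℂ)) μ :=
      (Integrable.of_bound (f := fun x : Rd d => Real.cos (inner ℝ x t))
        (Measurable.aestronglyMeasurable (by fun_prop)) 1
        (Eventually.of_forall fun x => Real.abs_cos_le_one _)).ofReal
    have hs : Integrable (fun x : Rd d => (Real.sin (inner ℝ x t) : ℂ)) μ :=
      (Integrable.of_bound (f := fun x : Rd d => Real.sin (inner ℝ x t))
        (Measurable.aestronglyMeasurable (by fun_prop)) 1
        (Eventually.of_forall fun x => Real.abs_sin_le_one _)).ofReal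
    rw [charFun_apply, ← integral_complex_ofReal, ← integral_complex_ofReal, ← integral_mul_const,
      ← integral_add hc (hs.mul_const _)]
    congr 1 with x
    rw [Complex.exp_mul_I]
    push_cast
    rfl
  have hlip : ∀ g : ℝ → ℝ, LipschitzWith 1 g → ∃ L : ℝ, 0 < L ∧
      ∀ x y : Rd d, |g (inner ℝ x t) - g (inner ℝ y t)| ≤ L * ‖x - y‖ := by
    intro g hg
    -- The `+ 1` only keeps the constant positive when `t = 0`.
    refine ⟨‖t‖ + 1, by positivity, fun x y => ?_⟩
    have h1 := hg.dist_le_mul (inner ℝ x t) (inner ℝ y t)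
    rw [Real.dist_eq, Real.dist_eq, ← inner_sub_left, NNReal.coe_one, one_mul] at h1
    calc _ ≤ ‖x - y‖ * ‖t‖ := h1.trans (abs_real_inner_le_norm _ _)
      _ ≤ _ := by nlinarith [norm_nonneg (x - y)]
  by_cases hcos : ∫ x, Real.cos (inner ℝ x t) ∂P = ∫ x, Real.cos (inner ℝ x t) ∂Q
  · refine ⟨fun x => Real.sin (inner ℝ x t), by fun_prop, fun x => Real.abs_sin_le_one _,
      hlip _ Real.lipschitzWith_sin, fun h => ht ?_⟩
    rw [hre P, hre Q, hcos, h]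
  · exact ⟨fun x => Real.cos (inner ℝ x t), by fun_prop, fun x => Real.abs_cos_le_one _,
      hlip _ Real.lipschitzWith_cos, hcos⟩

/-! ### Empirical measures and the weak law of large numbers -/

theorem lintegral_empiricalMeasure {d n : ℕ} (x : Fin n → Rd d) (g : Rd d → ℝ≥0∞) :
    ∫⁻ y, g y ∂(empiricalMeasure x) = (n : ℝ≥0∞)⁻¹ * ∑ i, g (x i) := by
  rw [empiricalMeasure, lintegral_smul_measure, lintegral_finsetSum_measure, smul_eq_mul]
  simp

theorem isProbabilityMeasure_empiricalMeasure {d n : ℕ} (hn : n ≠ 0) (x : Fin n → Rd d) :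
    IsProbabilityMeasure (empiricalMeasure x) := by
  refine ⟨?_⟩
  rw [← lintegral_one, lintegral_empiricalMeasure]
  simp [ENNReal.inv_mul_cancel, hn]

theorem integral_empiricalMeasure {d n : ℕ} (x : Fin n → Rd d) (f : Rd d → ℝ) :
    ∫ y, f y ∂(empiricalMeasure x) = (n : ℝ)⁻¹ * ∑ i, f (x i) := by
  rw [empiricalMeasure, integral_smul_measure, integral_finsetSum_measure
    fun i _ => integrable_dirac (by simp)]
  simp

theorem lintegral_empiricalMeasure_ne_top {d n : ℕ} (hn : n ≠ 0) (x : Fin n → Rd d)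
    {g : Rd d → ℝ≥0∞} (hg : ∀ y, g y ≠ ∞) : ∫⁻ y, g y ∂(empiricalMeasure x) ≠ ∞ := by
  rw [lintegral_empiricalMeasure]
  exact ENNReal.mul_ne_top (by simp [hn]) (ENNReal.sum_ne_top.2 fun i _ => hg _)

instance {d : ℕ} (Q : Measure (Rd d)) [IsProbabilityMeasure Q] (n : ℕ) :
    IsProbabilityMeasure (sampleLaw Q n) :=
  inferInstanceAs (IsProbabilityMeasure (Measure.pi _))

theorem lintegral_sampleLaw_empiricalMeasure {d n : ℕ} (hn : n ≠ 0) (Q : Measure (Rd d))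
    [IsProbabilityMeasure Q] {g : Rd d → ℝ≥0∞} (hg : Measurable g) :
    ∫⁻ x, ∫⁻ y, g y ∂(empiricalMeasure x) ∂(sampleLaw Q n) = ∫⁻ y, g y ∂Q := by
  have hi : ∀ i : Fin n, ∫⁻ x, g (x i) ∂(sampleLaw Q n) = ∫⁻ y, g y ∂Q := fun i =>
    (measurePreserving_eval (fun _ : Fin n => Q) i).lintegral_comp hg
  simp_rw [lintegral_empiricalMeasure]
  rw [lintegral_const_mul _ (by fun_prop), lintegral_finsetSum _ (by fun_prop)]
  simp only [hi, Finset.sum_const, Finset.card_univ, Fintype.card_fin, nsmul_eq_mul]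
  rw [← mul_assoc, ENNReal.inv_mul_cancel (by simpa) (by simp), one_mul]

/-- Weak law of large numbers for bounded functions. -/
theorem tendsto_sampleLaw_empirical_deviation {d : ℕ} (Q : Measure (Rd d))
    [IsProbabilityMeasure Q] {f : Rd d → ℝ} (hf : Measurable f) (hb : ∀ x, |f x| ≤ 1)
    {t : ℝ} (ht : 0 < t) :
    Tendsto (fun n => sampleLaw Q n
      {x | t ≤ |∫ y, f y ∂(empiricalMeasure x) - ∫ y, f y ∂Q|}) atTop (𝓝 0) := by
  have hL2 : MemLp f 2 Q := MemLp.of_bound hf.aestronglyMeasurable 1 (Eventually.of_forall hb)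
  have hvar : ProbabilityTheory.variance f Q ≤ 1 := by
    have := ProbabilityTheory.variance_le_sq_of_bounded (μ := Q) (a := -1) (b := 1)
      (Eventually.of_forall fun x => abs_le.1 (hb x)) hf.aemeasurable
    norm_num at this
    exact this
  have hbound : ∀ n : ℕ, n ≠ 0 → sampleLaw Q n
      {x | t ≤ |∫ y, f y ∂(empiricalMeasure x) - ∫ y, f y ∂Q|} ≤
        ENNReal.ofReal ((t ^ 2)⁻¹ * (n : ℝ)⁻¹) := by
    intro n hn
    have hn0 : (0 : ℝ) < n := by positivity
    set X : (Fin n → Rd d) → ℝ := ∑ i, fun x => f (x i) with hX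
    have hmem : ∀ i : Fin n, MemLp (fun x : Fin n → Rd d => f (x i)) 2 (sampleLaw Q n) := fun i =>
      hL2.comp_measurePreserving (measurePreserving_eval (fun _ : Fin n => Q) i)
    have hXmem : MemLp X 2 (sampleLaw Q n) := memLp_finsetSum' _ fun i _ => hmem i
    have hEi : ∀ i : Fin n, ∫ x, f (x i) ∂(sampleLaw Q n) = ∫ y, f y ∂Q := by
      intro i
      have h := (measurePreserving_eval (fun _ : Fin n => Q) i).map_eq
      conv_rhs => rw [← h, integral_map (measurable_pi_apply i).aemeasurable
        hf.aestronglyMeasurable]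
      rfl
    have hE : ∫ x, X x ∂(sampleLaw Q n) = n * ∫ y, f y ∂Q := by
      simp only [hX, Finset.sum_apply]
      rw [integral_finsetSum _ fun i _ => (hmem i).integrable (by norm_num)]
      simp [hEi]
    have hV : ProbabilityTheory.variance X (sampleLaw Q n) ≤ n := by
      rw [hX, sampleLaw, ProbabilityTheory.variance_sum_pi fun _ => hL2]
      simpa using mul_le_mul_of_nonneg_left hvar hn0.le
    calc _ ≤ sampleLaw Q n {x | n * t ≤ |X x - ∫ x, X x ∂(sampleLaw Q n)|} := by
          refine measure_mono fun x hx => ?_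
          simp only [Set.mem_ofPred_eq] at hx ⊢
          rw [integral_empiricalMeasure] at hx
          have hx' : X x - n * ∫ y, f y ∂Q = n * ((n : ℝ)⁻¹ * ∑ i, f (x i) - ∫ y, f y ∂Q) := by
            rw [mul_sub, mul_inv_cancel_left₀ hn0.ne', hX, Finset.sum_apply]
          rw [hE, hx', abs_mul, abs_of_pos hn0]
          gcongr
      _ ≤ _ := ProbabilityTheory.meas_ge_le_variance_div_sq hXmem (by positivity)
      _ ≤ ENNReal.ofReal (n / (n * t) ^ 2) := by gcongr
      _ = _ := by
          congr 1
          field_simp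
  refine tendsto_of_tendsto_of_tendsto_of_le_of_le' tendsto_const_nhds (h := fun n : ℕ =>
    ENNReal.ofReal ((t ^ 2)⁻¹ * (n : ℝ)⁻¹)) ?_ (Eventually.of_forall fun _ => zero_le)
    ((eventually_ne_atTop 0).mono hbound)
  rw [← ENNReal.ofReal_zero]
  refine ENNReal.tendsto_ofReal ?_
  simpa using (tendsto_inv_atTop_nhds_zero_nat (𝕜 := ℝ)).const_mul (t ^ 2)⁻¹

/-! ### Convergence of the empirical measure in transport cost -/

/-- A countable partition into cells of small diameter, finitely many of which carry almost all
of a given finite mass. -/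
theorem exists_cells {d : ℕ} (Q : Measure (Rd d)) [IsFiniteMeasure Q] {g : Rd d → ℝ≥0∞}
    (hg : ∫⁻ x, g x ∂Q ≠ ∞) {δ : ℝ} (hδ : 0 < δ) {θ : ℝ≥0∞} (hθ : 0 < θ) :
    ∃ (A : ℕ → Set (Rd d)) (N : ℕ) (R : ℝ), (∀ j, MeasurableSet (A j)) ∧
      Pairwise (Function.onFun Disjoint A) ∧ (∀ j, ∀ x ∈ A j, ∀ y ∈ A j, ‖x - y‖ ≤ δ) ∧
      0 ≤ R ∧ (∀ j < N, ∀ x ∈ A j, ‖x‖ ≤ R) ∧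
      ∫⁻ x in (⋃ j ∈ Finset.range N, A j)ᶜ, g x ∂Q ≤ θ := by
  set c := TopologicalSpace.denseSeq (Rd d)
  set A : ℕ → Set (Rd d) := disjointed fun j => Metric.ball (c j) (δ / 2) with hAdef
  have hAm : ∀ j, MeasurableSet (A j) := fun j =>
    MeasurableSet.disjointed (fun _ => measurableSet_ball) j
  have hsub : ∀ j, A j ⊆ Metric.ball (c j) (δ / 2) := fun j => disjointed_subset _ j
  have hcov : ⋃ j, A j = Set.univ := by
    rw [hAdef, iUnion_disjointed]
    refine Set.eq_univ_of_forall fun x => ?_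
    obtain ⟨j, hj⟩ := (TopologicalSpace.denseRange_denseSeq (Rd d)).exists_dist_lt x
      (half_pos hδ)
    exact Set.mem_iUnion.2 ⟨j, hj⟩
  set B : ℕ → Set (Rd d) := fun N => (⋃ j ∈ Finset.range N, A j)ᶜ with hB
  have hBm : ∀ N, MeasurableSet (B N) := fun N =>
    (Finset.measurableSet_biUnion _ fun j _ => hAm j).compl
  have hBanti : Antitone B := fun M N h =>
    Set.compl_subset_compl.2 (Set.biUnion_subset_biUnion_left
      fun j hj => Finset.range_mono h hj)
  have hBi : ⋂ N, B N = ∅ := by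
    refine Set.eq_empty_of_forall_notMem fun x hx => ?_
    obtain ⟨j, hj⟩ := Set.mem_iUnion.1 (hcov.symm ▸ Set.mem_univ x : x ∈ ⋃ j, A j)
    exact Set.mem_iInter.1 hx (j + 1)
      (Set.mem_biUnion (Finset.mem_coe.2 (Finset.self_mem_range_succ j)) hj)
  have hlim : Tendsto (fun N => Q (B N)) atTop (𝓝 0) := by
    have := tendsto_measure_iInter_atTop (μ := Q) (fun N => (hBm N).nullMeasurableSet) hBanti
      ⟨0, measure_ne_top _ _⟩
    rwa [hBi, measure_empty] at this
  obtain ⟨N, hN⟩ := ((tendsto_setLIntegral_zero hg hlim).eventually_le_const hθ).exists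
  -- A sum serves as a crude common bound on the norms in the cells, also when `N = 0`.
  refine ⟨A, N, ∑ j ∈ Finset.range N, (‖c j‖ + δ), hAm, disjoint_disjointed _, ?_,
    by positivity, ?_, hN⟩
  · intro j x hx y hy
    have h1 := Metric.mem_ball.1 (hsub j hx)
    have h2 := Metric.mem_ball.1 (hsub j hy)
    have := dist_triangle_right x y (c j)
    rw [← dist_eq_norm]
    linarith
  · intro j hj x hx
    refine le_trans ?_ (Finset.single_le_sum (f := fun j => ‖c j‖ + δ) (fun j _ => by positivity)
      (Finset.mem_range.2 hj))
    have h1 := Metric.mem_ball.1 (hsub j hx)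
    rw [dist_eq_norm] at h1
    have := norm_le_norm_add_norm_sub' x (c j)
    change ‖x‖ ≤ ‖c j‖ + δ
    linarith

theorem measure_tsub_le_of_abs_real_lt {Ω : Type*} [MeasurableSpace Ω] (μ ν : Measure Ω)
    [IsFiniteMeasure μ] [IsFiniteMeasure ν] {s : Set Ω} {τ : ℝ}
    (h : |μ.real s - ν.real s| < τ) : μ s - ν s ≤ ENNReal.ofReal τ := by
  rw [← ofReal_measureReal (μ := μ), ← ofReal_measureReal (μ := ν),
    ← ENNReal.ofReal_sub _ measureReal_nonneg]
  exact ENNReal.ofReal_le_ofReal ((le_abs_self _).trans h.le)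

/-- The empirical measure converges in probability to the sampled measure in the transport cost. -/
theorem tendsto_sampleLaw_transportCost {d : ℕ} {p : ℝ} (hp : 1 ≤ p) (Q : Measure (Rd d))
    [IsProbabilityMeasure Q] (hQ : ∫⁻ x, ENNReal.ofReal (‖x‖ ^ p) ∂Q ≠ ∞) {ε : ℝ} (hε : 0 < ε) :
    Tendsto (fun n => sampleLaw Q n
      {x | ENNReal.ofReal ε < transportCost p (empiricalMeasure x) Q}) atTop (𝓝 0) := by
  refine ENNReal.tendsto_nhds_zero.2 fun κ hκ => ?_
  have hκ2 : 0 < κ / 2 := ENNReal.half_pos hκ.ne'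
  have hp0 : 0 < p := by linarith
  -- The budget is `ε / 4` from the cell diameter plus `2 ^ p * (3 * a)`: two tails of size `a`, and
  -- cell discrepancies of total `a`.
  set a : ℝ := ε / (4 * 2 ^ p) with ha
  have ha0 : 0 < a := by positivity
  have ha1 : 0 < ENNReal.ofReal a := ENNReal.ofReal_pos.2 ha0
  obtain ⟨A, N, R, hAm, hAd, hAδ, hR0, hAR, htail⟩ := exists_cells Q hQ
    (δ := (ε / 4) ^ p⁻¹) (by positivity)
    -- The first bound controls the tail of `Q` itself; the second makes Markov's inequality at
    -- level `a` give `κ / 2` for the empirical tail.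
    (θ := min (ENNReal.ofReal a) (κ / 2 * ENNReal.ofReal a))
    (lt_min ha1 (ENNReal.mul_pos hκ2.ne' ha1.ne'))
  set U : Set (Rd d) := (⋃ j ∈ Finset.range N, A j)ᶜ with hU
  have hUm : MeasurableSet U := (Finset.measurableSet_biUnion _ fun j _ => hAm j).compl
  set g : Rd d → ℝ≥0∞ := U.indicator fun x => ENNReal.ofReal (‖x‖ ^ p) with hg
  have hgm : Measurable g := Measurable.indicator (by fun_prop) hUm
  set τ : ℝ := a / (2 * (N + 1) * (R ^ p + 1)) with hτ
  have hRp : 0 ≤ R ^ p := by positivity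
  have hτ0 : 0 < τ := by positivity
  have hτa : R ^ p * (N * τ) + R ^ p * (N * τ) ≤ a := by
    have h1 : R ^ p * N * 2 ≤ 2 * (N + 1) * (R ^ p + 1) := by
      have : (0 : ℝ) ≤ N := by positivity
      nlinarith
    calc _ = (R ^ p * N * 2) * τ := by ring
      _ ≤ (2 * (N + 1) * (R ^ p + 1)) * τ := by gcongr
      _ = a := by rw [hτ]; field_simp
  have hsum : Tendsto (fun n => ∑ j ∈ Finset.range N, sampleLaw Q n
      {x | τ ≤ |(empiricalMeasure x).real (A j) - Q.real (A j)|}) atTop (𝓝 0) := by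
    rw [← Finset.sum_const_zero (s := Finset.range N)]
    refine tendsto_finsetSum _ fun j _ => ?_
    have h := tendsto_sampleLaw_empirical_deviation Q
      (f := (A j).indicator 1) (measurable_one.indicator (hAm j))
      (fun x => by by_cases hx : x ∈ A j <;> simp [hx]) hτ0
    simpa only [integral_indicator_one (hAm j)] using h
  filter_upwards [hsum.eventually_le_const hκ2, eventually_ne_atTop 0] with n hn hn0
  have hmarkov : sampleLaw Q n
      {x | ENNReal.ofReal a ≤ ∫⁻ y, g y ∂(empiricalMeasure x)} ≤ κ / 2 := by
    refine (meas_ge_le_lintegral_div ?_ ha1.ne' ENNReal.ofReal_ne_top).trans ?_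
    · simp_rw [lintegral_empiricalMeasure]
      exact ((Finset.measurable_fun_sum _ fun i _ =>
        hgm.comp (measurable_pi_apply i)).const_mul _).aemeasurable
    · rw [lintegral_sampleLaw_empiricalMeasure hn0 Q hgm, hg, lintegral_indicator hUm]
      exact ENNReal.div_le_of_le_mul (htail.trans (min_le_right _ _))
  have hincl : {x : Fin n → Rd d | ENNReal.ofReal ε < transportCost p (empiricalMeasure x) Q} ⊆
      (⋃ j ∈ Finset.range N, {x | τ ≤ |(empiricalMeasure x).real (A j) - Q.real (A j)|}) ∪
        {x | ENNReal.ofReal a ≤ ∫⁻ y, g y ∂(empiricalMeasure x)} := by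
    intro x hx
    by_contra hcon
    simp only [Set.mem_union, Set.mem_iUnion, Set.mem_ofPred_eq, exists_prop, not_or, not_exists,
      not_and, not_le] at hcon
    obtain ⟨hcell, hxt⟩ := hcon
    have := isProbabilityMeasure_empiricalMeasure hn0 x
    refine (not_le.2 hx) ((transportCost_le_of_cells (empiricalMeasure x) Q N hp hAm hAd hAδ
      hAR).trans ?_)
    rw [hg, lintegral_indicator hUm] at hxt
    have hs1 : ∑ j ∈ Finset.range N, ((empiricalMeasure x) (A j) - Q (A j)) ≤
        ENNReal.ofReal (N * τ) := by
      refine (Finset.sum_le_card_nsmul _ _ _ fun j hj =>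
        measure_tsub_le_of_abs_real_lt _ _ (hcell j hj)).trans_eq ?_
      rw [Finset.card_range, nsmul_eq_mul, ENNReal.ofReal_mul (by positivity),
        ENNReal.ofReal_natCast]
    have hs2 : ∑ j ∈ Finset.range N, (Q (A j) - (empiricalMeasure x) (A j)) ≤
        ENNReal.ofReal (N * τ) := by
      refine (Finset.sum_le_card_nsmul _ _ _ fun j hj =>
        measure_tsub_le_of_abs_real_lt _ _ ((abs_sub_comm _ _).trans_lt (hcell j hj))).trans_eq ?_
      rw [Finset.card_range, nsmul_eq_mul, ENNReal.ofReal_mul (by positivity),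
        ENNReal.ofReal_natCast]
    calc _ ≤ ENNReal.ofReal (((ε / 4) ^ p⁻¹) ^ p) + ENNReal.ofReal (2 ^ p) *
          ((ENNReal.ofReal (R ^ p) * ENNReal.ofReal (N * τ) + ENNReal.ofReal a) +
            (ENNReal.ofReal (R ^ p) * ENNReal.ofReal (N * τ) + ENNReal.ofReal a)) := by
          gcongr
          exact htail.trans (min_le_left _ _)
      _ = ENNReal.ofReal (ε / 4 + 2 ^ p * ((R ^ p * (N * τ) + a) + (R ^ p * (N * τ) + a))) := by
          rw [Real.rpow_inv_rpow (by positivity) hp0.ne', ENNReal.ofReal_add (by positivity)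
            (by positivity), ENNReal.ofReal_mul (p := 2 ^ p) (by positivity),
            ENNReal.ofReal_add (by positivity) (by positivity), ENNReal.ofReal_add (by positivity) ha0.le,
            ENNReal.ofReal_mul hRp]
      _ ≤ ENNReal.ofReal ε := by
          apply ENNReal.ofReal_le_ofReal
          calc _ ≤ ε / 4 + 2 ^ p * (3 * a) := by gcongr; linarith
            _ = ε := by rw [ha]; field_simp; norm_num
  calc _ ≤ _ := measure_mono hincl
    _ ≤ _ := measure_union_le _ _
    _ ≤ κ / 2 + κ / 2 := add_le_add ((measure_biUnion_finset_le _ _).trans hn) hmarkov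
    _ = κ := ENNReal.add_halves κ

/-! ### Consistency of the test -/

/-- Subadditivity alone suffices, so the events need not be measurable; measurability of the test
statistic never has to be proved. -/
theorem tendsto_real_one_of_compl {Ω : ℕ → Type*} [∀ n, MeasurableSpace (Ω n)]
    (μ : ∀ n, Measure (Ω n)) [∀ n, IsProbabilityMeasure (μ n)] {S T : ∀ n, Set (Ω n)}
    (hT : Tendsto (fun n => μ n (T n)) atTop (𝓝 0)) (hST : ∀ᶠ n in atTop, (S n)ᶜ ⊆ T n) :
    Tendsto (fun n => (μ n).real (S n)) atTop (𝓝 1) := by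
  have hT' : Tendsto (fun n => 1 - (μ n).real (T n)) atTop (𝓝 1) := by
    have := ((ENNReal.tendsto_toReal ENNReal.zero_ne_top).comp hT).const_sub 1
    simpa [Measure.real] using this
  refine tendsto_of_tendsto_of_tendsto_of_le_of_le' hT' tendsto_const_nhds ?_
    (Eventually.of_forall fun _ => measureReal_le_one)
  filter_upwards [hST] with n hn
  have h1 : (μ n).real Set.univ ≤ (μ n).real (S n ∪ T n) := measureReal_mono fun x _ => by
    by_cases hx : x ∈ S n
    · exact Or.inl hx
    · exact Or.inr (hn hx)
  have h2 := measureReal_union_le (μ := μ n) (S n) (T n)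
  rw [probReal_univ] at h1
  linarith

theorem tendsto_nullCDF {d : ℕ} {p : ℝ} (hp : 1 ≤ p) (P₀ : Measure (Rd d))
    [IsProbabilityMeasure P₀] (hP₀ : ∫⁻ x, ENNReal.ofReal (‖x‖ ^ p) ∂P₀ ≠ ∞) {ε : ℝ}
    (hε : 0 < ε) : Tendsto (fun n => nullCDF p P₀ n ε) atTop (𝓝 1) := by
  refine tendsto_real_one_of_compl (fun n => sampleLaw P₀ n)
    (tendsto_sampleLaw_transportCost hp P₀ hP₀ hε) (Eventually.of_forall fun n x hx => ?_)
  by_contra hcon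
  refine hx ?_
  rw [Set.mem_ofPred_eq, testStat_eq_toReal_transportCost hp]
  exact ENNReal.toReal_le_of_le_ofReal hε.le (not_lt.1 hcon)

/-- Under a law other than `P₀` the test statistic stays away from zero. -/
theorem exists_tendsto_sampleLaw_testStat_lt {d : ℕ} {p : ℝ} (hp : 1 ≤ p) (P₀ : Measure (Rd d))
    [IsProbabilityMeasure P₀] (hP₀ : ∫⁻ x, ENNReal.ofReal (‖x‖ ^ p) ∂P₀ ≠ ∞)
    (P : Measure (Rd d)) [IsProbabilityMeasure P] (hne : P ≠ P₀) :
    ∃ ε : ℝ, 0 < ε ∧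
      Tendsto (fun n => sampleLaw P n {x | testStat p P₀ x < ε}) atTop (𝓝 0) := by
  obtain ⟨f, hf, hb, ⟨L, hL, hLip⟩, hfne⟩ := exists_lipschitz_integral_ne hne
  set Δ := |∫ x, f x ∂P - ∫ x, f x ∂P₀| with hΔ
  have hΔ0 : 0 < Δ := abs_pos.2 (sub_ne_zero.2 hfne)
  have hη : 0 < Δ / (4 * L) := by positivity
  refine ⟨(Δ / (4 * L)) ^ p, by positivity, ?_⟩
  refine tendsto_of_tendsto_of_tendsto_of_le_of_le' tendsto_const_nhds
    (tendsto_sampleLaw_empirical_deviation P hf hb (half_pos hΔ0))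
    (Eventually.of_forall fun _ => zero_le) ?_
  filter_upwards [eventually_ne_atTop 0] with n hn
  refine measure_mono fun x hx => ?_
  by_contra hcon
  rw [Set.mem_ofPred_eq, not_le] at hcon
  have := isProbabilityMeasure_empiricalMeasure hn x
  -- Off the deviation event the empirical mean is within `Δ / 2` of the mean under `P`, leaving a
  -- gap of at least `Δ / 2` to `P₀`; this fixes `η = Δ / (4 * L)`.
  have hgap : 2 * L * (Δ / (4 * L)) ≤ |∫ y, f y ∂(empiricalMeasure x) - ∫ y, f y ∂P₀| := by
    have h1 : 2 * L * (Δ / (4 * L)) = Δ / 2 := by field_simp; norm_num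
    have h2 := abs_sub_le (∫ y, f y ∂P) (∫ y, f y ∂(empiricalMeasure x)) (∫ y, f y ∂P₀)
    rw [abs_sub_comm (∫ y, f y ∂P) (∫ y, f y ∂(empiricalMeasure x))] at h2
    linarith
  have hle := ofReal_rpow_le_transportCost hp (empiricalMeasure x) P₀ hf hb hL hη hLip hgap
  have htop := transportCost_ne_top (empiricalMeasure x) P₀ hp
    (lintegral_empiricalMeasure_ne_top hn x fun _ => ENNReal.ofReal_ne_top) hP₀
  rw [Set.mem_ofPred_eq, testStat_eq_toReal_transportCost hp] at hx
  exact absurd ((ENNReal.ofReal_le_iff_le_toReal htop).1 hle) (not_le.2 hx)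

theorem mainTheorem5 (d : ℕ) (p : ℝ) (hp : 1 ≤ p)
    (P₀ : Measure (Rd d)) [IsProbabilityMeasure P₀]
    (hP₀ : Integrable (fun x : Rd d => ‖x‖ ^ p) P₀)
    (P : Measure (Rd d)) [IsProbabilityMeasure P] (hne : P ≠ P₀)
    (α : ℝ) (hα : 0 < α) :
    Tendsto (fun n : ℕ => (sampleLaw P n).real {x | wassersteinTest p P₀ α x = 1})
      atTop (𝓝 1) ∧
    Tendsto (fun n : ℕ => (sampleLaw P n).real {x | pValue p P₀ x ≤ α})
      atTop (𝓝 1) ∧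
    Tendsto (fun n : ℕ => (sampleLaw P n).real {x | criticalValue p P₀ α n < testStat p P₀ x})
      atTop (𝓝 1) := by
  have hmom : ∫⁻ x, ENNReal.ofReal (‖x‖ ^ p) ∂P₀ ≠ ∞ :=
    (lintegral_ofReal_ne_top_iff_integrable hP₀.aestronglyMeasurable
      (Eventually.of_forall fun x => by positivity)).2 hP₀
  obtain ⟨ε, hε, hT⟩ := exists_tendsto_sampleLaw_testStat_lt hp P₀ hmom P hne
  -- Halving `ε` leaves room for the strict inequality in the third limit.
  have hcdf : ∀ᶠ n in atTop, 1 - α ≤ nullCDF p P₀ n (ε / 2) :=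
    (tendsto_nullCDF hp P₀ hmom (half_pos hε)).eventually_const_le (by linarith)
  have hcrit : ∀ {n : ℕ}, 1 - α ≤ nullCDF p P₀ n (ε / 2) → criticalValue p P₀ α n ≤ ε / 2 :=
    fun h => csInf_le ⟨0, fun t ht => ht.1.le⟩ ⟨half_pos hε, h⟩
  refine ⟨tendsto_real_one_of_compl (fun n => sampleLaw P n) hT ?_,
    tendsto_real_one_of_compl (fun n => sampleLaw P n) hT ?_,
    tendsto_real_one_of_compl (fun n => sampleLaw P n) hT ?_⟩ <;>
  filter_upwards [hcdf] with n hn x hx <;> by_contra hcon <;> refine hx ?_ <;>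
  rw [Set.mem_ofPred_eq, not_lt] at hcon
  · have := hcrit hn
    exact if_pos (by linarith)
  · have hmono : nullCDF p P₀ n (ε / 2) ≤ nullCDF p P₀ n (testStat p P₀ x) :=
      measureReal_mono fun y (hy : testStat p P₀ y ≤ ε / 2) => by
        change testStat p P₀ y ≤ _
        linarith
    rw [Set.mem_ofPred_eq, pValue]
    linarith
  · have := hcrit hn
    rw [Set.mem_ofPred_eq]
    linarith
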